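/- Let $P(n,d)$ denote the maximum size of an $(n,d)$ permutation array, i.e. of a set $C$ of permutations of an $n$-element set such that any two distinct members of $C$ differ in at least $d$ points. A permutation group has fixity $f$ if each of its nontrivial elements fixes at most $f$ points and some nontrivial element fixes exactly $f$ points. Let $M_{24}$ be the group of all permutations of the 24 coordinates that preserve the extended binary Golay code (the extended quadratic residue code modulo 23, with coordinates indexed by the projective line over $\mathbb{F}_{23}$). Let $M_{23}$ be the stabilizer in $M_{24}$ of any one point, acting on the remaining 23 points, and $M_{22}$ the pointwise stabilizer in $M_{24}$ of any two distinct points, acting on the remaining 22 points. **Lemma.** 1. $M_{24}$ has fixity at most $8$ and order $244823040$, and its elements form a $(24,16)$ permutation array. 2. $M_{23}$ has fixity at most $7$ (on its 23 points) and order $10200960$, and its elements form a $(23,16)$ permutation array. 3. $M_{22}$ has fixity at most $6$ (on its 22 points) and order $443520$, and its elements form a $(22,16)$ permutation array. Consequently $P(24,16)\ge 244823040$, $P(23,16)\ge 10200960$ and $P(22,16)\ge 443520$. -/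

import Mathlib

section PermutationArrays

/-- An `(n, d)` permutation array: a set `C` of permutations of a set `Ω` with `n` elements, any two
distinct members of which differ in at least `d` points. -/
def IsPermArray {Ω : Type*} [Fintype Ω] [DecidableEq Ω] (n d : ℕ) (C : Set (Equiv.Perm Ω)) : Prop :=
  Fintype.card Ω = n ∧ C.Pairwise fun x y => d ≤ hammingDist (⇑x) (⇑y)

/-- `P(n, d)`, the maximum size of an `(n, d)` permutation array. -/
noncomputable def maxPermArray (n d : ℕ) : ℕ :=
  sSup {M | ∃ C : Set (Equiv.Perm (Fin n)), IsPermArray n d C ∧ C.ncard = M}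

/-- The supremum in `maxPermArray` is attained. -/
theorem maxPermArray_isGreatest (n d : ℕ) :
    IsGreatest {M | ∃ C : Set (Equiv.Perm (Fin n)), IsPermArray n d C ∧ C.ncard = M}
      (maxPermArray n d) := by
  have hb : BddAbove {M | ∃ C : Set (Equiv.Perm (Fin n)), IsPermArray n d C ∧ C.ncard = M} := by
    refine ⟨Nat.card (Equiv.Perm (Fin n)), ?_⟩
    rintro M ⟨C, -, rfl⟩
    exact Set.ncard_le_card C
  exact ⟨Nat.sSup_mem ⟨0, ∅, ⟨Fintype.card_fin n, Set.pairwise_empty _⟩, Set.ncard_empty _⟩ hb,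
    fun M hM => le_csSup hb hM⟩

/-- The permutation group `G` has fixity `f`: every nontrivial element of `G` fixes at most `f`
points, and some nontrivial element fixes exactly `f` points. -/
def HasFixity {Ω : Type*} [Finite Ω] (G : Subgroup (Equiv.Perm Ω)) (f : ℕ) : Prop :=
  (∀ g ∈ G, g ≠ 1 → (Function.fixedPoints g).ncard ≤ f) ∧
    ∃ g ∈ G, g ≠ 1 ∧ (Function.fixedPoints g).ncard = f

end PermutationArrays

section MathieuGroups

/-- The projective line over the field with 23 elements: 24 points. -/
abbrev ProjLine23 : Type := Option (ZMod 23)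

/-- The binary word supported on `∞` (that is, `none`) and on the points `a + r`, where `r` runs
through the nonzero squares modulo 23. -/
def golayWord (a : ZMod 23) : ProjLine23 → ZMod 2
  | none => 1
  | some x => if IsSquare (x - a) ∧ x ≠ a then 1 else 0

/-- The extended binary Golay code, as the extended quadratic residue code modulo 23. -/
def golayCode : Submodule (ZMod 2) (ProjLine23 → ZMod 2) :=
  Submodule.span (ZMod 2) (Set.range golayWord)

/-- The Mathieu group `M₂₄`: all permutations of the 24 coordinates that preserve the extended
binary Golay code. -/
def mathieu24 : Subgroup (Equiv.Perm ProjLine23) where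
  carrier := {σ | ∀ c : ProjLine23 → ZMod 2, c ∘ σ ∈ golayCode ↔ c ∈ golayCode}
  one_mem' := fun _ => Iff.rfl
  mul_mem' := fun {σ τ} hσ hτ c => (hτ (c ∘ σ)).trans (hσ c)
  inv_mem' := fun {σ} hσ c => by
    have h := hσ (c ∘ ⇑σ⁻¹)
    have e : (c ∘ ⇑σ⁻¹) ∘ ⇑σ = c := by
      funext x
      simp
    rw [e] at h
    exact h.symm

/-- The Mathieu group `M₂₃`: the stabilizer of the point `a` in `M₂₄`, as a permutation group of
the other 23 points. (`Equiv.Perm.ofSubtype` extends a permutation by the identity.) -/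
def mathieu23 (a : ProjLine23) : Subgroup (Equiv.Perm {x : ProjLine23 // x ≠ a}) :=
  mathieu24.comap Equiv.Perm.ofSubtype

/-- The Mathieu group `M₂₂`: the pointwise stabilizer of two points `a ≠ b` in `M₂₄`, as a
permutation group of the other 22 points. -/
def mathieu22 (a b : ProjLine23) : Subgroup (Equiv.Perm {x : ProjLine23 // x ≠ a ∧ x ≠ b}) :=
  mathieu24.comap Equiv.Perm.ofSubtype

end MathieuGroups

/-!
The proof determines the action of `M₂₄` on a base of seven points. Words are encoded as bit masks,
so that the following finite facts about explicit words and permutations are checked by evaluation: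
the code has no nonzero word of weight at most `6` (`eq_zero_of_hammingNorm_le_six`), certain masks
are octads, that is, code words of weight `8`, and certain tables define elements of `M₂₄`
(`IsAutTable.exists_mem_mathieu24`).

Two octads with five common points are equal (`octad_eq_of_five_le_card`). Hence an element of `M₂₄`
that fixes five points of an octad maps the octad to itself. The base consists of six points of an
octad `O` and a point outside `O`. The stabilizer of the first five base points preserves `O`, so
the orbits of the successive base points have at most `24`, `23`, `22`, `21`, `20`, `3` and `16`
elements, and the explicit elements show that these numbers are attained. An element that fixes the
whole base preserves the fifteen octads through the last base point and four of the others. These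
force it to fix all but at most two points, and one more octad distinguishes those two, so it is
trivial (`baseStab_seven`). The orbit-stabilizer theorem gives the order of `M₂₄`, and with
transitivity on pairs of points also the orders of `M₂₃` and `M₂₂`.

The bounds on fixed points reduce to `numFixed_le_eight`. Since any six points of an octad together
with a point outside it can be moved to the base, an element that fixes such seven points is
trivial. Given nine fixed points, five of them may be moved to the first five base points. If
another fixed point lies in `O`, then six fixed points lie in `O`. Otherwise there are two fixed
points outside `O`, and they lie in an octad with four of the five base points
(`exists_octad_through_point`). In both cases an octad contains six fixed points, and some fixed
point is outside it because an octad has only eight points.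

Two distinct elements `x` and `y` of a permutation group differ exactly at the points that `x⁻¹ * y`
does not fix, so the bounds on fixed points are bounds on the Hamming distance.
-/

/-! ### Binary words as bit masks -/

/-- The 24 coordinates numbered from `0` to `23`: the element `x` of the field has number `x`, and
`∞` has number `23`. -/
def point : Fin 24 ≃ ProjLine23 := finSuccEquivLast (n := 23)

/-- The binary word whose value at the coordinate with number `i` is the `i`-th bit of `m`. -/
def word (m : ℕ) : ProjLine23 → ZMod 2 := fun p => if m.testBit (point.symm p) then 1 else 0

theorem word_point (m : ℕ) (i : Fin 24) : word m (point i) = if m.testBit i then 1 else 0 := by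
  simp [word]

theorem word_eq_word_iff {m n : ℕ} {p q : ProjLine23} :
    word m p = word n q ↔ m.testBit (point.symm p) = n.testBit (point.symm q) := by
  unfold word
  cases m.testBit (point.symm p) <;> cases n.testBit (point.symm q) <;> simp

theorem word_ne_zero_iff {m : ℕ} {p : ProjLine23} :
    word m p ≠ 0 ↔ m.testBit (point.symm p) = true := by
  unfold word
  cases m.testBit (point.symm p) <;> simp

theorem word_zero : word 0 = 0 := by
  funext p
  simp [word]

theorem word_xor (m n : ℕ) : word (m ^^^ n) = word m + word n := by
  funext p
  simp only [word, Nat.testBit_xor, Pi.add_apply]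
  cases m.testBit (point.symm p) <;> cases n.testBit (point.symm p) <;> decide

theorem hammingNorm_word (m : ℕ) :
    hammingNorm (word m) = Nat.count (fun i => m.testBit i = true) 24 := by
  rw [Nat.count_eq_card_filter_range]
  refine Finset.card_bij (fun p _ => (point.symm p : ℕ)) ?_ ?_ ?_
  · intro p hp
    simp only [Finset.mem_filter, Finset.mem_univ, true_and, word_ne_zero_iff] at hp
    simp [hp]
  · intro p _ q _ h
    exact point.symm.injective (Fin.ext h)
  · intro i hi
    simp only [Finset.mem_filter, Finset.mem_range] at hi
    refine ⟨point ⟨i, hi.1⟩, ?_, by simp⟩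
    simp [word_ne_zero_iff, hi.2]

/-- The sum (exclusive or) of those masks in a list whose positions are bits of `k`. -/
def xorComb : List ℕ → ℕ → ℕ
  | [], _ => 0
  | b :: l, k => (if k.testBit 0 then b else 0) ^^^ xorComb l (k / 2)

theorem word_xorComb_mem {V : Submodule (ZMod 2) (ProjLine23 → ZMod 2)} {l : List ℕ}
    (h : ∀ b ∈ l, word b ∈ V) (k : ℕ) : word (xorComb l k) ∈ V := by
  induction l generalizing k with
  | nil => simp [xorComb, word_zero]
  | cons b l ih =>
    rw [xorComb, word_xor]
    refine V.add_mem ?_ (ih (fun c hc => h c (List.mem_cons_of_mem _ hc)) _)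
    split_ifs
    · exact h b List.mem_cons_self
    · simp [word_zero]

/-- All sums of sublists of a list of masks. -/
def xorCombs : List ℕ → List ℕ
  | [] => [0]
  | b :: l => xorCombs l ++ (xorCombs l).map (b ^^^ ·)

theorem exists_mem_xorCombs {l : List ℕ} {c : ProjLine23 → ZMod 2}
    (hc : c ∈ Submodule.span (ZMod 2) (word '' {b | b ∈ l})) : ∃ m ∈ xorCombs l, c = word m := by
  induction l generalizing c with
  | nil => simpa [xorCombs, word_zero] using hc
  | cons b l ih =>
    have e : word '' {x | x ∈ b :: l} = insert (word b) (word '' {x | x ∈ l}) := by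
      ext w
      simp [eq_comm]
    rw [e, Submodule.mem_span_insert] at hc
    obtain ⟨a, z, hz, rfl⟩ := hc
    obtain ⟨m, hm, rfl⟩ := ih hz
    have ha : a = 0 ∨ a = 1 := by
      revert a
      decide
    rcases ha with rfl | rfl
    · exact ⟨m, List.mem_append_left _ hm, by simp⟩
    · exact ⟨b ^^^ m, List.mem_append_right _ (List.mem_map_of_mem hm), by simp [word_xor]⟩

/-! ### The extended binary Golay code -/

/-- The mask of `golayWord a`. Multiplication by `2 ^ a` modulo `2 ^ 23 - 1` rotates the mask
`340830` of the nonzero squares by `a` places. -/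
def golayMask (a : ℕ) : ℕ := 2 ^ 23 + 340830 * 2 ^ a % (2 ^ 23 - 1)

theorem word_golayMask (a : ZMod 23) : word (golayMask a.val) = golayWord a := by
  funext p
  revert a p
  decide +kernel

/-- A basis of the code in systematic form: among the bits `0, …, 11` of the `i`-th mask, only
bit `i` is set. -/
def golayRows : List ℕ :=
  [11415553, 14442498, 1503236, 3006472, 6012944, 10072096, 11755584, 15122560, 6533376, 15290880,
    8164352, 14096384]

/-- The coordinates of the systematic basis with respect to the words `golayWord 0`, …,
`golayWord 11`. -/
def golayRowCoords : List ℕ :=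
  [2630, 19, 2656, 95, 190, 2874, 747, 1494, 490, 2450, 3581, 1315]

theorem golayRows_eq :
    golayRows = golayRowCoords.map (xorComb ((List.range 12).map golayMask)) := by
  decide +kernel

theorem word_golayRow_mem {r : ℕ} (hr : r ∈ golayRows) : word r ∈ golayCode := by
  rw [golayRows_eq, List.mem_map] at hr
  obtain ⟨k, -, rfl⟩ := hr
  refine word_xorComb_mem (fun b hb => ?_) k
  obtain ⟨a, ha, rfl⟩ := List.mem_map.1 hb
  have ha' : a < 23 := (List.mem_range.1 ha).trans (by norm_num)
  rw [← ZMod.val_natCast_of_lt ha', word_golayMask]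
  exact Submodule.subset_span ⟨_, rfl⟩

theorem golayCode_eq_span :
    golayCode = Submodule.span (ZMod 2) (word '' {r | r ∈ golayRows}) := by
  refine le_antisymm (Submodule.span_le.2 ?_) (Submodule.span_le.2 ?_)
  · rintro _ ⟨a, rfl⟩
    -- in systematic form, the first twelve bits of a code word are its coordinates
    have h : ∀ a : ZMod 23, golayMask a.val = xorComb golayRows (golayMask a.val) := by
      decide +kernel
    rw [SetLike.mem_coe, ← word_golayMask, h]
    exact word_xorComb_mem (fun b hb => Submodule.subset_span (Set.mem_image_of_mem word hb)) _
  · rintro _ ⟨r, hr, rfl⟩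
    exact word_golayRow_mem hr

/-- A mask is recognized as a code word by being the combination of the systematic basis that its
first twelve bits prescribe. -/
theorem word_mem_golayCode {m : ℕ} (h : xorComb golayRows m = m) : word m ∈ golayCode := by
  rw [← h]
  exact word_xorComb_mem (fun _ => word_golayRow_mem) _

theorem eq_zero_of_hammingNorm_le_six {c : ProjLine23 → ZMod 2} (hc : c ∈ golayCode)
    (h : hammingNorm c ≤ 6) : c = 0 := by
  rw [golayCode_eq_span] at hc
  obtain ⟨m, hm, rfl⟩ := exists_mem_xorCombs hc
  have key : (xorCombs golayRows).all
      (fun m => m == 0 || Nat.blt 6 (Nat.count (fun i => m.testBit i = true) 24)) = true := by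
    decide +kernel
  have := List.all_eq_true.1 key m hm
  rw [hammingNorm_word] at h
  simp only [Bool.or_eq_true, beq_iff_eq, Nat.blt_eq] at this
  rcases this with rfl | h'
  · exact word_zero
  · omega

/-! ### Octads -/

theorem comp_mem_golayCode {g : Equiv.Perm ProjLine23} (hg : g ∈ mathieu24)
    {c : ProjLine23 → ZMod 2} (hc : c ∈ golayCode) : c ∘ g ∈ golayCode :=
  (hg c).2 hc

theorem hammingNorm_comp_perm (g : Equiv.Perm ProjLine23) (c : ProjLine23 → ZMod 2) :
    hammingNorm (c ∘ g) = hammingNorm c := by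
  refine Finset.card_equiv g fun p => ?_
  simp

/-- Two octads with five common points are equal, because their sum has weight at most `6`. -/
theorem octad_eq_of_five_le_card {c d : ProjLine23 → ZMod 2} (hc : c ∈ golayCode)
    (hd : d ∈ golayCode) (hc8 : hammingNorm c = 8) (hd8 : hammingNorm d = 8)
    {s : Finset ProjLine23} (hs : 5 ≤ s.card) (hcs : ∀ p ∈ s, c p ≠ 0) (hds : ∀ p ∈ s, d p ≠ 0) :
    c = d := by
  classical
  have one : ∀ a : ZMod 2, a ≠ 0 → a = 1 := by decide
  rw [← sub_eq_zero]
  refine eq_zero_of_hammingNorm_le_six (golayCode.sub_mem hc hd) ?_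
  have hsub : Finset.univ.filter (fun p => (c - d) p ≠ 0) ⊆
      (Finset.univ.filter (fun p => c p ≠ 0) \ s) ∪
        (Finset.univ.filter (fun p => d p ≠ 0) \ s) := by
    intro p hp
    have hp' : c p - d p ≠ 0 := by simpa using hp
    have hps : p ∉ s := fun h => hp' (by rw [one _ (hcs p h), one _ (hds p h), sub_self])
    by_cases h : c p = 0
    · have : d p ≠ 0 := fun h' => hp' (by rw [h, h', sub_self])
      simp [hps, this]
    · simp [hps, h]
  have h1 := Finset.card_sdiff_add_card_eq_card (s := s)
    (t := Finset.univ.filter (fun p => c p ≠ 0))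
    (fun p hp => by simpa using hcs p hp)
  have h2 := Finset.card_sdiff_add_card_eq_card (s := s)
    (t := Finset.univ.filter (fun p => d p ≠ 0))
    (fun p hp => by simpa using hds p hp)
  have h3 := (Finset.card_le_card hsub).trans (Finset.card_union_le _ _)
  unfold hammingNorm at hc8 hd8 ⊢
  omega

theorem octad_comp_eq_self {g : Equiv.Perm ProjLine23} (hg : g ∈ mathieu24)
    {c : ProjLine23 → ZMod 2} (hc : c ∈ golayCode) (hc8 : hammingNorm c = 8)
    {s : Finset ProjLine23} (hs : 5 ≤ s.card) (hcs : ∀ p ∈ s, c p ≠ 0) (hgs : ∀ p ∈ s, g p = p) :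
    c ∘ g = c :=
  octad_eq_of_five_le_card (comp_mem_golayCode hg hc) hc ((hammingNorm_comp_perm g c).trans hc8) hc8
    hs (fun p hp => by simpa [hgs p hp] using hcs p hp) hcs

/-- The mask `m` represents an octad. -/
abbrev IsOctadMask (m : ℕ) : Prop :=
  xorComb golayRows m = m ∧ Nat.count (fun i => m.testBit i = true) 24 = 8

theorem IsOctadMask.hammingNorm_eq {m : ℕ} (h : IsOctadMask m) : hammingNorm (word m) = 8 :=
  (hammingNorm_word m).trans h.2

/-- An element of `M₂₄` that fixes the points of the mask `F` maps each octad with at least five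
points in `F` to itself, so it fixes every point that a list of such octads distinguishes from all
others. -/
theorem fixes_of_octads_separate {g : Equiv.Perm ProjLine23} (hg : g ∈ mathieu24) {F : ℕ}
    (hF : ∀ i : Fin 24, F.testBit i = true → g (point i) = point i) {L : List ℕ}
    (hL : ∀ m ∈ L, IsOctadMask m ∧ 5 ≤ Nat.count (fun i => (m &&& F).testBit i = true) 24)
    {i : Fin 24}
    (hi : ∀ j : Fin 24, (∀ m ∈ L, m.testBit j = m.testBit i) → j = i) : g (point i) = point i := by
  rw [← point.symm_apply_eq]
  refine hi _ fun m hm => ?_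
  obtain ⟨ho, h5⟩ := hL m hm
  rw [← hammingNorm_word] at h5
  have key := octad_comp_eq_self hg (word_mem_golayCode ho.1) ho.hammingNorm_eq h5 (fun p hp => ?_)
    (fun p hp => ?_)
  · have := congrFun key (point i)
    rw [Function.comp_apply, word_eq_word_iff] at this
    simpa using this
  · have := word_ne_zero_iff.1 (Finset.mem_filter.1 hp).2
    rw [Nat.testBit_and, Bool.and_eq_true] at this
    exact word_ne_zero_iff.2 this.1
  · have := word_ne_zero_iff.1 (Finset.mem_filter.1 hp).2
    rw [Nat.testBit_and, Bool.and_eq_true] at this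
    simpa using hF _ this.2

/-! ### Automorphisms given by tables -/

theorem mem_mathieu24_of_forall_comp_mem {σ : Equiv.Perm ProjLine23}
    (h : ∀ r ∈ golayRows, word r ∘ σ ∈ golayCode) : σ ∈ mathieu24 := by
  let f := LinearEquiv.funCongrLeft (ZMod 2) (ZMod 2) σ
  have hle : golayCode.map (f : (ProjLine23 → ZMod 2) →ₗ[ZMod 2] (ProjLine23 → ZMod 2)) ≤
      golayCode := by
    conv_lhs => rw [golayCode_eq_span]
    rw [Submodule.map_span, Submodule.span_le]
    rintro _ ⟨_, ⟨r, hr, rfl⟩, rfl⟩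
    exact h r hr
  have heq := Submodule.eq_of_le_of_finrank_eq hle (LinearEquiv.finrank_map_eq f golayCode)
  intro c
  conv_lhs => rw [← heq]
  constructor
  · rintro ⟨d, hd, hdc⟩
    have : d = c := f.injective hdc
    exact this ▸ hd
  · exact fun hc => ⟨c, hc, rfl⟩

/-- The mask of the word `w ∘ s`, where `w` is the word of the mask `m` and `s` is given by the
table of its values. -/
def permMask : List (Fin 24) → ℕ → ℕ
  | [], _ => 0
  | j :: s, m => Nat.bit (m.testBit j) (permMask s m)

theorem testBit_permMask {s : List (Fin 24)} (m : ℕ) {i : ℕ} (hi : i < s.length) :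
    (permMask s m).testBit i = m.testBit (s.getD i 0) := by
  induction s generalizing i with
  | nil => simp at hi
  | cons j s ih =>
    cases i with
    | zero => simp [permMask]
    | succ i =>
      rw [permMask, Nat.testBit_bit_succ, ih (by simpa using hi)]
      simp

/-- The table `s` of values is that of a permutation of the coordinates that maps the words of the
systematic basis into the code. -/
abbrev IsAutTable (s : List (Fin 24)) : Prop :=
  s.length = 24 ∧ s.Nodup ∧ ∀ r ∈ golayRows, xorComb golayRows (permMask s r) = permMask s r

theorem IsAutTable.exists_mem_mathieu24 {s : List (Fin 24)} (h : IsAutTable s) :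
    ∃ g ∈ mathieu24, ∀ i : Fin 24, g (point i) = point (s.getD i 0) := by
  obtain ⟨hlen, hnd, hcode⟩ := h
  have hinj : Function.Injective fun i : Fin 24 => s.getD i 0 := by
    intro i j hij
    have hi : (i : ℕ) < s.length := i.2.trans_eq hlen.symm
    have hj : (j : ℕ) < s.length := j.2.trans_eq hlen.symm
    simp only [List.getD_eq_getElem _ _ hi, List.getD_eq_getElem _ _ hj] at hij
    exact Fin.ext ((hnd.getElem_inj_iff).1 hij)
  let σ : Equiv.Perm (Fin 24) := Equiv.ofBijective _ (Finite.injective_iff_bijective.1 hinj)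
  refine ⟨point.permCongr σ, mem_mathieu24_of_forall_comp_mem fun r hr => ?_, fun i => ?_⟩
  · convert word_mem_golayCode (hcode r hr) using 1
    funext p
    rw [Function.comp_apply, word_eq_word_iff,
      testBit_permMask r ((point.symm p).2.trans_eq hlen.symm)]
    simp [σ]
  · simp [σ]

/-- The points reachable from those of a list in at most `n` steps, each by one of the tables. -/
def reach (gens : List (List (Fin 24))) : ℕ → List (Fin 24) → List (Fin 24)
  | 0, l => l
  | n + 1, l => reach gens n (l ++ gens.flatMap fun s => l.map fun i => s.getD i 0).dedup

theorem exists_apply_eq_of_mem_reach {H : Subgroup (Equiv.Perm ProjLine23)}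
    {gens : List (List (Fin 24))}
    (hg : ∀ s ∈ gens, ∃ g ∈ H, ∀ i : Fin 24, g (point i) = point (s.getD i 0)) (b : ProjLine23)
    (n : ℕ) {l : List (Fin 24)} (hl : ∀ i ∈ l, ∃ g ∈ H, g b = point i) :
    ∀ i ∈ reach gens n l, ∃ g ∈ H, g b = point i := by
  induction n generalizing l with
  | zero => exact hl
  | succ n ih =>
    refine ih fun i hi => ?_
    rw [List.mem_dedup, List.mem_append, List.mem_flatMap] at hi
    rcases hi with hi | ⟨s, hs, hi⟩
    · exact hl i hi
    · obtain ⟨j, hj, rfl⟩ := List.mem_map.1 hi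
      obtain ⟨g, hgH, hgb⟩ := hl j hj
      obtain ⟨k, hkH, hk⟩ := hg s hs
      exact ⟨k * g, H.mul_mem hkH hgH, by rw [Equiv.Perm.mul_apply, hgb, hk]⟩

/-! ### Pointwise stabilizers along a base -/

/-- The pointwise stabilizer in `M₂₄` of a set of points. -/
def pointStab (s : Set ProjLine23) : Subgroup (Equiv.Perm ProjLine23) :=
  mathieu24 ⊓ fixingSubgroup (Equiv.Perm ProjLine23) s

theorem mem_pointStab {s : Set ProjLine23} {g : Equiv.Perm ProjLine23} :
    g ∈ pointStab s ↔ g ∈ mathieu24 ∧ ∀ x ∈ s, g x = x := by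
  simp [pointStab, Subgroup.mem_inf, mem_fixingSubgroup_iff]

/-- The orbit-stabilizer theorem for the pointwise stabilizer of a set `s` and its orbit `S` of the
point `b`. -/
theorem card_pointStab {s : Set ProjLine23} {b : ProjLine23} {S : Finset ProjLine23}
    (h : ∀ x, x ∈ S ↔ ∃ g ∈ pointStab s, g b = x) :
    Nat.card (pointStab s) = S.card * Nat.card (pointStab (insert b s)) := by
  have e : Nat.card (MulAction.stabilizer (pointStab s) b) = Nat.card (pointStab (insert b s)) :=
    Nat.card_congr
      { toFun := fun g => ⟨g.1.1, mem_pointStab.2 ⟨(mem_pointStab.1 g.1.2).1, by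
          rintro x (rfl | hx)
          · exact g.2
          · exact (mem_pointStab.1 g.1.2).2 x hx⟩⟩
        invFun := fun g => ⟨⟨g.1, mem_pointStab.2 ⟨(mem_pointStab.1 g.2).1, fun x hx =>
          (mem_pointStab.1 g.2).2 x (Set.mem_insert_of_mem b hx)⟩⟩,
          (mem_pointStab.1 g.2).2 b (Set.mem_insert b s)⟩
        left_inv := fun _ => rfl
        right_inv := fun _ => rfl }
  have o : MulAction.orbit (pointStab s) b = (S : Set ProjLine23) := by
    ext x
    rw [Finset.mem_coe, h]
    constructor
    · rintro ⟨g, rfl⟩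
      exact ⟨g.1, g.2, rfl⟩
    · rintro ⟨g, hg, rfl⟩
      exact ⟨⟨g, hg⟩, rfl⟩
  rw [← Subgroup.index_mul_card (MulAction.stabilizer (pointStab s) b), MulAction.index_stabilizer,
    o, Set.ncard_coe_finset, e]

/-- The numbers of seven points that form a base of `M₂₄`: six points of an octad and one point
outside it. -/
def baseNumbers : List (Fin 24) := [23, 0, 1, 2, 3, 9, 4]

/-- The `k`-th point of the base, counted from zero. -/
def basePoint (k : ℕ) : ProjLine23 := point (baseNumbers.getD k 0)

/-- The octad through the first six points of the base. -/
def baseOctad : ℕ := 10490383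

theorem isOctadMask_baseOctad : IsOctadMask baseOctad := by decide +kernel

/-- The pointwise stabilizer of the first `k` points of the base. -/
def baseStab (k : ℕ) : Subgroup (Equiv.Perm ProjLine23) := pointStab (basePoint '' Set.Iio k)

theorem mem_baseStab {k : ℕ} {g : Equiv.Perm ProjLine23} :
    g ∈ baseStab k ↔ g ∈ mathieu24 ∧ ∀ j < k, g (basePoint j) = basePoint j := by
  simp [baseStab, mem_pointStab]

/-- The orbit of the `k`-th point of the base under the pointwise stabilizer of the previous ones:
all remaining points for `k < 5`, the remaining points of the octad for `k = 5`, and the points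
outside the octad for `k = 6`. -/
def baseOrbit (k : ℕ) : Finset (Fin 24) :=
  Finset.univ.filter fun i => (∀ j < k, i ≠ baseNumbers.getD j 0) ∧
    (k = 5 → baseOctad.testBit i = true) ∧ (k = 6 → baseOctad.testBit i = false)

/-- Tables of elements of `M₂₄`. The first two are the transformations `x ↦ -1/x` and `x ↦ x + 1`
of the projective line. Counting from zero, the `k`-th table fixes the first `k` points of the base
for `k ≤ 6`, and the last four tables fix the first six points; these four generate the group of
order `16` that fixes the octad pointwise and is regular on its complement. -/
def autTables : List (List (Fin 24)) :=
  [[23, 22, 11, 15, 17, 9, 19, 13, 20, 5, 16, 2, 21, 7, 18, 3, 10, 4, 14, 6, 8, 12, 1, 0],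
    [1, 2, 3, 4, 5, 6, 7, 8, 9, 10, 11, 12, 13, 14, 15, 16, 17, 18, 19, 20, 21, 22, 0, 23],
    [0, 4, 1, 9, 21, 3, 5, 11, 19, 14, 16, 2, 22, 10, 12, 7, 8, 17, 13, 20, 18, 15, 6, 23],
    [0, 1, 4, 2, 12, 13, 11, 3, 9, 19, 20, 15, 18, 16, 8, 5, 21, 7, 17, 10, 22, 6, 14, 23],
    [0, 1, 2, 7, 22, 15, 8, 21, 19, 17, 16, 6, 13, 9, 3, 5, 10, 12, 20, 11, 4, 14, 18, 23],
    [0, 1, 2, 3, 4, 11, 18, 16, 7, 21, 22, 14, 9, 10, 5, 20, 8, 15, 19, 6, 17, 12, 13, 23],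
    [0, 1, 2, 3, 10, 19, 16, 20, 14, 9, 4, 17, 12, 22, 8, 18, 6, 11, 15, 5, 7, 21, 13, 23],
    [0, 1, 2, 3, 19, 10, 18, 13, 11, 9, 5, 8, 12, 7, 17, 16, 15, 14, 6, 4, 22, 21, 20, 23],
    [0, 1, 2, 3, 7, 22, 14, 4, 16, 9, 20, 15, 12, 19, 6, 11, 8, 18, 17, 13, 10, 21, 5, 23],
    [0, 1, 2, 3, 11, 14, 22, 15, 19, 9, 17, 4, 12, 16, 5, 7, 13, 10, 20, 8, 18, 21, 6, 23]]

theorem isAutTable_of_mem_autTables : ∀ s ∈ autTables, IsAutTable s := by decide +kernel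

theorem autTables_fix_base : ∀ k < 7, ∀ s ∈ autTables.drop k, ∀ j < k,
    s.getD (baseNumbers.getD j 0) 0 = baseNumbers.getD j 0 := by
  decide +kernel

theorem baseOrbit_subset_reach : ∀ k < 7, ∀ i ∈ baseOrbit k,
    i ∈ reach (autTables.drop k) 5 [baseNumbers.getD k 0] := by
  decide +kernel

theorem exists_mem_baseStab_of_mem_baseOrbit {k : ℕ} (hk : k < 7) {i : Fin 24}
    (hi : i ∈ baseOrbit k) : ∃ g ∈ baseStab k, g (basePoint k) = point i := by
  refine exists_apply_eq_of_mem_reach (fun s hs => ?_) _ 5 ?_ i (baseOrbit_subset_reach k hk i hi)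
  · obtain ⟨g, hg, hgs⟩ :=
      (isAutTable_of_mem_autTables s (List.mem_of_mem_drop hs)).exists_mem_mathieu24
    refine ⟨g, mem_baseStab.2 ⟨hg, fun j hj => ?_⟩, hgs⟩
    rw [basePoint, hgs, autTables_fix_base k hk s hs j hj]
  · intro i hi
    rw [List.mem_singleton] at hi
    exact ⟨1, one_mem _, by rw [hi]; rfl⟩

theorem basePoint_mem_octad {k : ℕ} (hk : k < 6) : word baseOctad (basePoint k) ≠ 0 := by
  rw [basePoint, word_ne_zero_iff, Equiv.symm_apply_apply]
  revert k
  decide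

theorem basePoint_six_notMem_octad : word baseOctad (basePoint 6) = 0 := by
  rw [basePoint, word_point]
  decide

theorem basePoint_inj {j k : ℕ} (hj : j < 7) (hk : k < 7) : basePoint j = basePoint k ↔ j = k := by
  rw [basePoint, basePoint, point.apply_eq_iff_eq]
  have : ∀ j < 7, ∀ k < 7, baseNumbers.getD j 0 = baseNumbers.getD k 0 ↔ j = k := by decide
  exact this j hj k hk

/-- An octad through the first five points of the base is the base octad. -/
theorem eq_word_baseOctad {c : ProjLine23 → ZMod 2} (hc : c ∈ golayCode) (hc8 : hammingNorm c = 8)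
    (h : ∀ k < 5, c (basePoint k) ≠ 0) : c = word baseOctad := by
  have hinj : Set.InjOn basePoint (Finset.range 5 : Set ℕ) := fun j hj k hk e => by
    rw [Finset.coe_range, Set.mem_Iio] at hj hk
    exact (basePoint_inj (by omega) (by omega)).1 e
  refine octad_eq_of_five_le_card hc (word_mem_golayCode isOctadMask_baseOctad.1) hc8
    isOctadMask_baseOctad.hammingNorm_eq (s := (Finset.range 5).image basePoint) ?_ ?_ ?_
  · rw [Finset.card_image_of_injOn hinj, Finset.card_range]
  · intro p hp
    obtain ⟨k, hk, rfl⟩ := Finset.mem_image.1 hp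
    exact h k (Finset.mem_range.1 hk)
  · intro p hp
    obtain ⟨k, hk, rfl⟩ := Finset.mem_image.1 hp
    exact basePoint_mem_octad ((Finset.mem_range.1 hk).trans (by norm_num))

theorem mem_baseOrbit {k : ℕ} {x : ProjLine23} :
    point.symm x ∈ baseOrbit k ↔ (∀ j < k, x ≠ basePoint j) ∧
      (k = 5 → word baseOctad x ≠ 0) ∧ (k = 6 → word baseOctad x = 0) := by
  simp only [baseOrbit, basePoint, Finset.mem_filter, Finset.mem_univ, true_and, ne_eq,
    Equiv.symm_apply_eq, word_ne_zero_iff]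
  simp [word]

theorem apply_basePoint_mem_baseOrbit {k : ℕ} (hk : k < 7) {g : Equiv.Perm ProjLine23}
    (hg : g ∈ baseStab k) : point.symm (g (basePoint k)) ∈ baseOrbit k := by
  obtain ⟨hg, hfix⟩ := mem_baseStab.1 hg
  have hoct : 5 ≤ k → word baseOctad (g (basePoint k)) = word baseOctad (basePoint k) := by
    intro h5
    refine congrFun (eq_word_baseOctad (c := word baseOctad ∘ g) (comp_mem_golayCode hg
      (word_mem_golayCode isOctadMask_baseOctad.1)) ?_ fun j hj => ?_) (basePoint k)
    · rw [hammingNorm_comp_perm, isOctadMask_baseOctad.hammingNorm_eq]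
    · rw [Function.comp_apply, hfix j (by omega)]
      exact basePoint_mem_octad (by omega)
  refine mem_baseOrbit.2 ⟨fun j hj h => ?_, ?_, ?_⟩
  · have : basePoint k = basePoint j := g.injective (by rw [h, hfix j hj])
    rw [basePoint_inj hk (by omega)] at this
    omega
  · rintro rfl
    rw [hoct le_rfl]
    exact basePoint_mem_octad (by norm_num)
  · rintro rfl
    rw [hoct (by norm_num)]
    exact basePoint_six_notMem_octad

/-- The mask of the base. -/
def baseMask : ℕ := 8389151

/-- The octads through the last point of the base and four of the other six. -/
def baseOctads : List ℕ :=
  [1212447, 9175127, 8454555, 12632595, 9011740, 8528473, 17118, 4457245, 8520502, 12592158,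
    525883, 9438869, 8407101, 76311, 9701914]

theorem baseOctads_isOctadMask : ∀ m ∈ baseOctads,
    IsOctadMask m ∧ 5 ≤ Nat.count (fun i => (m &&& baseMask).testBit i = true) 24 := by
  decide +kernel

theorem baseStab_seven : baseStab 7 = ⊥ := by
  refine (Subgroup.eq_bot_iff_forall _).2 fun g hg => ?_
  obtain ⟨hg, hfix⟩ := mem_baseStab.1 hg
  have h1 : ∀ i : Fin 24, baseMask.testBit i = true → g (point i) = point i := by
    intro i hi
    have : ∀ i : Fin 24, baseMask.testBit i = true → ∃ j < 7, i = baseNumbers.getD j 0 := by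
      decide +kernel
    obtain ⟨j, hj, rfl⟩ := this i hi
    exact hfix j hj
  -- the mask `2 ^ 24 - 1 - 2 ^ 12 - 2 ^ 21` omits the two points of the base octad outside the base
  have h2 : ∀ i : Fin 24, (14675967).testBit i = true → g (point i) = point i := by
    intro i hi
    refine fixes_of_octads_separate hg h1 baseOctads_isOctadMask fun j hj => ?_
    have key : ∀ i : Fin 24, (14675967).testBit i = true → ∀ j : Fin 24,
        (∀ m ∈ baseOctads, m.testBit j = m.testBit i) → j = i := by
      decide +kernel
    exact key i hi j hj
  -- one more octad distinguishes these two points from each other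
  have h3 : ∀ i : Fin 24, g (point i) = point i := by
    intro i
    have hL : ∀ m ∈ 1503236 :: baseOctads, IsOctadMask m ∧
        5 ≤ Nat.count (fun i => (m &&& 14675967).testBit i = true) 24 := by
      decide +kernel
    have key : ∀ i j : Fin 24,
        (∀ m ∈ 1503236 :: baseOctads, m.testBit j = m.testBit i) → j = i := by
      decide +kernel
    exact fixes_of_octads_separate hg h2 hL (key i)
  ext x : 1
  simpa using h3 (point.symm x)

theorem card_baseStab {k : ℕ} (hk : k < 7) :
    Nat.card (baseStab k) = (baseOrbit k).card * Nat.card (baseStab (k + 1)) := by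
  have e : baseStab (k + 1) = pointStab (insert (basePoint k) (basePoint '' Set.Iio k)) := by
    rw [baseStab, ← Set.image_insert_eq]
    congr 2
    ext j
    simp [Nat.le_iff_lt_or_eq, or_comm]
  rw [e, baseStab, card_pointStab (b := basePoint k) (S := (baseOrbit k).map point.toEmbedding),
    Finset.card_map]
  intro x
  rw [Finset.mem_map_equiv]
  constructor
  · intro hx
    simpa [baseStab] using exists_mem_baseStab_of_mem_baseOrbit hk hx
  · rintro ⟨g, hg, rfl⟩
    exact apply_basePoint_mem_baseOrbit hk hg

theorem card_mathieu24 : Nat.card mathieu24 = 244823040 := by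
  have h0 : mathieu24 = baseStab 0 := by
    ext g
    simp [mem_baseStab]
  have h : ∀ k < 7, (baseOrbit k).card = [24, 23, 22, 21, 20, 3, 16].getD k 0 := by decide +kernel
  rw [h0, card_baseStab, card_baseStab, card_baseStab, card_baseStab, card_baseStab,
    card_baseStab, card_baseStab, baseStab_seven, h 0, h 1, h 2, h 3, h 4, h 5, h 6] <;> simp

/-! ### Transitivity and fixed points -/

/-- The base can be moved by `M₂₄` onto any sequence of points each of which lies, after the
previous ones have been moved back to the base, in the corresponding orbit. -/
theorem exists_map_basePoint (x : ℕ → ProjLine23) {n : ℕ} (hn : n ≤ 7)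
    (hx : ∀ k < n, ∀ h ∈ mathieu24, (∀ j < k, h (basePoint j) = x j) →
      point.symm (h⁻¹ (x k)) ∈ baseOrbit k) :
    ∃ h ∈ mathieu24, ∀ j < n, h (basePoint j) = x j := by
  induction n with
  | zero => exact ⟨1, one_mem _, by simp⟩
  | succ n ih =>
    obtain ⟨h, hh, hj⟩ := ih (by omega) fun k hk => hx k (by omega)
    obtain ⟨g, hg, hgn⟩ :=
      exists_mem_baseStab_of_mem_baseOrbit (by omega) (hx n (by omega) h hh hj)
    obtain ⟨hg, hfix⟩ := mem_baseStab.1 hg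
    refine ⟨h * g, mul_mem hh hg, fun j hjn => ?_⟩
    rcases Nat.lt_succ_iff_lt_or_eq.1 hjn with hlt | rfl
    · rw [Equiv.Perm.mul_apply, hfix j hlt, hj j hlt]
    · simp [hgn]

theorem inv_apply_ne_basePoint {x : ℕ → ProjLine23} {n k : ℕ} (hx : Set.InjOn x (Set.Iio n))
    (hk : k < n) {h : Equiv.Perm ProjLine23} (hh : ∀ j < k, h (basePoint j) = x j) :
    ∀ j < k, h⁻¹ (x k) ≠ basePoint j := by
  intro j hj e
  rw [Equiv.Perm.inv_eq_iff_eq, hh j hj] at e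
  have := hx (Set.mem_Iio.2 hk) (Set.mem_Iio.2 (hj.trans hk)) e
  omega

/-- `M₂₄` is 5-transitive. -/
theorem exists_map_basePoint_of_injOn {x : ℕ → ProjLine23} {n : ℕ} (hn : n ≤ 5)
    (hx : Set.InjOn x (Set.Iio n)) : ∃ h ∈ mathieu24, ∀ j < n, h (basePoint j) = x j :=
  exists_map_basePoint x (by omega) fun _ hk _ _ hj => mem_baseOrbit.2
    ⟨inv_apply_ne_basePoint hx hk hj, by omega, by omega⟩

theorem exists_map_basePoint_of_octad {c : ProjLine23 → ZMod 2} (hc : c ∈ golayCode)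
    (hc8 : hammingNorm c = 8) {x : ℕ → ProjLine23} (hx : Set.InjOn x (Set.Iio 6))
    (hxc : ∀ k < 6, c (x k) ≠ 0) (hx6 : c (x 6) = 0) :
    ∃ h ∈ mathieu24, ∀ j < 7, h (basePoint j) = x j := by
  have hinj : Set.InjOn x (Set.Iio 7) := by
    intro i hi j hj e
    rw [Set.mem_Iio] at hi hj
    rcases Nat.lt_succ_iff_lt_or_eq.1 hi with hi | rfl <;>
      rcases Nat.lt_succ_iff_lt_or_eq.1 hj with hj | rfl
    · exact hx hi hj e
    · exact absurd hx6 (e ▸ hxc i hi)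
    · exact absurd hx6 (e ▸ hxc j hj)
    · rfl
  refine exists_map_basePoint x le_rfl fun k hk h hh hj => mem_baseOrbit.2
    ⟨inv_apply_ne_basePoint hinj hk hj, ?_⟩
  have hoct : 5 ≤ k → word baseOctad (h⁻¹ (x k)) = c (x k) := by
    intro h5
    rw [← eq_word_baseOctad (c := c ∘ h) (comp_mem_golayCode hh hc)
      ((hammingNorm_comp_perm h c).trans hc8) fun j hj5 => ?_]
    · simp
    · rw [Function.comp_apply, hj j (by omega)]
      exact hxc j (by omega)
  constructor
  · rintro rfl
    rw [hoct le_rfl]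
    exact hxc 5 (by norm_num)
  · rintro rfl
    rw [hoct (by norm_num)]
    exact hx6

theorem eq_one_of_conj_eq_one {g h : Equiv.Perm ProjLine23} (H : h⁻¹ * g * h = 1) : g = 1 := by
  have := congrArg (fun k => h * k * h⁻¹) H
  simpa [mul_assoc] using this

theorem conj_mem_mathieu24 {g h : Equiv.Perm ProjLine23} (hg : g ∈ mathieu24) (hh : h ∈ mathieu24) :
    h⁻¹ * g * h ∈ mathieu24 :=
  mul_mem (mul_mem (inv_mem hh) hg) hh

theorem conj_apply_eq {g h : Equiv.Perm ProjLine23} {x y : ProjLine23} (hxy : h x = y)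
    (hy : g y = y) : (h⁻¹ * g * h) x = x := by
  rw [Equiv.Perm.mul_apply, Equiv.Perm.mul_apply, hxy, hy, Equiv.Perm.inv_eq_iff_eq, hxy]

/-- A nontrivial element of `M₂₄` cannot fix six points of an octad and a point outside it, since
these seven points can be moved to the base. -/
theorem eq_one_of_fixes_six_of_octad {g : Equiv.Perm ProjLine23} (hg : g ∈ mathieu24)
    {c : ProjLine23 → ZMod 2} (hc : c ∈ golayCode) (hc8 : hammingNorm c = 8)
    {s : Finset ProjLine23} (hs : 6 ≤ s.card) (hcs : ∀ p ∈ s, c p ≠ 0) (hgs : ∀ p ∈ s, g p = p)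
    {z : ProjLine23} (hcz : c z = 0) (hgz : g z = z) : g = 1 := by
  obtain ⟨t, hts, ht⟩ := Finset.exists_subset_card_eq hs
  let e : Fin 6 ≃ t := (t.equivFinOfCardEq ht).symm
  let x : ℕ → ProjLine23 := fun k => if h : k < 6 then e ⟨k, h⟩ else z
  have hxs : ∀ k < 6, x k ∈ s := fun k hk => by
    simp only [x, hk, dif_pos]
    exact hts (e _).2
  have hx6 : x 6 = z := by simp [x]
  have hinj : Set.InjOn x (Set.Iio 6) := by
    intro i hi j hj hij
    rw [Set.mem_Iio] at hi hj
    simp only [x, hi, hj, dif_pos] at hij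
    simpa using e.injective (Subtype.ext hij)
  obtain ⟨h, hh, hb⟩ := exists_map_basePoint_of_octad hc hc8 hinj (fun k hk => hcs _ (hxs k hk))
    (hx6 ▸ hcz)
  have hgx : ∀ k < 7, g (x k) = x k := by
    intro k hk
    rcases Nat.lt_succ_iff_lt_or_eq.1 hk with hk | rfl
    · exact hgs _ (hxs k hk)
    · rw [hx6, hgz]
  have key : h⁻¹ * g * h ∈ baseStab 7 := mem_baseStab.2
    ⟨conj_mem_mathieu24 hg hh, fun j hj => conj_apply_eq (hb j hj) (hgx j hj)⟩
  rw [baseStab_seven, Subgroup.mem_bot] at key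
  exact eq_one_of_conj_eq_one key

theorem exists_mem_notMem_octad {c : ProjLine23 → ZMod 2} (hc8 : hammingNorm c = 8)
    {s : Finset ProjLine23} (hs : 9 ≤ s.card) : ∃ z ∈ s, c z = 0 := by
  by_contra! h
  have : s.card ≤ hammingNorm c := Finset.card_le_card fun p hp => by simpa using h p hp
  omega

/-- The number of fixed points of a permutation of the coordinates. -/
def numFixed (g : Equiv.Perm ProjLine23) : ℕ := (Finset.univ.filter fun p => g p = p).card

theorem numFixed_conj (g h : Equiv.Perm ProjLine23) : numFixed (h⁻¹ * g * h) = numFixed g := by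
  refine Finset.card_equiv h fun p => ?_
  rw [Finset.mem_filter_univ, Finset.mem_filter_univ, Equiv.Perm.mul_apply, Equiv.Perm.mul_apply,
    Equiv.Perm.inv_eq_iff_eq]

theorem eq_one_of_fixes_six_of_octad_of_nine_le {g : Equiv.Perm ProjLine23} (hg : g ∈ mathieu24)
    (h9 : 9 ≤ numFixed g) {m : ℕ} (hm : IsOctadMask m) {s : Finset ProjLine23} (hs : 6 ≤ s.card)
    (hms : ∀ p ∈ s, word m p ≠ 0) (hgs : ∀ p ∈ s, g p = p) : g = 1 := by
  obtain ⟨z, hz, hmz⟩ := exists_mem_notMem_octad hm.hammingNorm_eq h9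
  exact eq_one_of_fixes_six_of_octad hg (word_mem_golayCode hm.1) hm.hammingNorm_eq hs hms hgs hmz
    (by simpa using hz)

/-- Every point outside the base octad and different from the last point of the base lies in an
octad through that last point and four of the first five points of the base. (There are five such
octads, each contains three further points, and these cover all fifteen points in question.) The
mask `8388639` is that of the base points other than the sixth. -/
theorem exists_octad_through_point : ∀ i : Fin 24, baseOctad.testBit i = false → i ≠ 4 →
    ∃ m ∈ baseOctads,
      6 ≤ Nat.count (fun j => (m &&& (8388639 ||| 2 ^ (i : ℕ))).testBit j = true) 24 := by
  decide +kernel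

theorem eq_one_of_fixes_base_five_six {g : Equiv.Perm ProjLine23} (hg : g ∈ mathieu24)
    (h9 : 9 ≤ numFixed g) (hb : ∀ k < 5, g (basePoint k) = basePoint k)
    (h6 : g (basePoint 6) = basePoint 6) {y : ProjLine23} (hy : g y = y)
    (hyo : word baseOctad y = 0) (hy6 : y ≠ basePoint 6) : g = 1 := by
  obtain ⟨i, rfl⟩ := point.surjective y
  have hi : baseOctad.testBit i = false := by simpa [word_point] using hyo
  obtain ⟨m, hm, hm6⟩ := exists_octad_through_point i hi fun h => hy6 (h ▸ rfl)
  rw [← hammingNorm_word] at hm6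
  refine eq_one_of_fixes_six_of_octad_of_nine_le hg h9 (baseOctads_isOctadMask m hm).1 hm6
    (fun p hp => ?_) (fun p hp => ?_)
  · have := word_ne_zero_iff.1 (Finset.mem_filter.1 hp).2
    rw [Nat.testBit_and, Bool.and_eq_true] at this
    exact word_ne_zero_iff.2 this.1
  · have := word_ne_zero_iff.1 (Finset.mem_filter.1 hp).2
    rw [Nat.testBit_and, Bool.and_eq_true, Nat.testBit_or, Bool.or_eq_true] at this
    obtain ⟨j, rfl⟩ := point.surjective p
    rw [Equiv.symm_apply_apply] at this
    rcases this.2 with h | h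
    · have key : ∀ j : Fin 24, (8388639).testBit j = true →
          j = baseNumbers.getD 6 0 ∨ ∃ k < 5, j = baseNumbers.getD k 0 := by
        decide +kernel
      rcases key j h with rfl | ⟨k, hk, rfl⟩
      · exact h6
      · exact hb k hk
    · rw [Nat.testBit_two_pow, decide_eq_true_eq] at h
      rw [← Fin.ext h, hy]

theorem eq_one_of_fixes_base_five {g : Equiv.Perm ProjLine23} (hg : g ∈ mathieu24)
    (h9 : 9 ≤ numFixed g) (hb : ∀ k < 5, g (basePoint k) = basePoint k) : g = 1 := by
  have hinj : Set.InjOn basePoint (Finset.range 5 : Set ℕ) := fun j hj k hk e => by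
    rw [Finset.coe_range, Set.mem_Iio] at hj hk
    exact (basePoint_inj (by omega) (by omega)).1 e
  have hcard : ((Finset.range 5).image basePoint).card = 5 := by
    rw [Finset.card_image_of_injOn hinj, Finset.card_range]
  by_cases H : ∃ p, g p = p ∧ word baseOctad p ≠ 0 ∧ p ∉ (Finset.range 5).image basePoint
  · obtain ⟨p, hp, hpo, hpb⟩ := H
    refine eq_one_of_fixes_six_of_octad_of_nine_le hg h9 isOctadMask_baseOctad
      (s := insert p ((Finset.range 5).image basePoint)) ?_ ?_ ?_
    · rw [Finset.card_insert_of_notMem hpb, hcard]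
    · intro q hq
      rcases Finset.mem_insert.1 hq with rfl | hq
      · exact hpo
      · obtain ⟨k, hk, rfl⟩ := Finset.mem_image.1 hq
        exact basePoint_mem_octad ((Finset.mem_range.1 hk).trans (by norm_num))
    · intro q hq
      rcases Finset.mem_insert.1 hq with rfl | hq
      · exact hp
      · obtain ⟨k, hk, rfl⟩ := Finset.mem_image.1 hq
        exact hb k (Finset.mem_range.1 hk)
  · push Not at H
    -- two of the fixed points lie outside the base octad; the first can be moved to the base
    have h2 : 1 <
        ((Finset.univ.filter fun p => g p = p) \ (Finset.range 5).image basePoint).card := by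
      have := Finset.le_card_sdiff ((Finset.range 5).image basePoint)
        (Finset.univ.filter fun p => g p = p)
      unfold numFixed at h9
      omega
    obtain ⟨x, hx, y, hy, hxy⟩ := Finset.one_lt_card.1 h2
    simp only [Finset.mem_sdiff, Finset.mem_filter, Finset.mem_univ, true_and] at hx hy
    have hxo : word baseOctad x = 0 := by_contra fun h => hx.2 (H x hx.1 h)
    have hyo : word baseOctad y = 0 := by_contra fun h => hy.2 (H y hy.1 h)
    obtain ⟨h, hh, hhx⟩ := exists_mem_baseStab_of_mem_baseOrbit (k := 6) (by norm_num)
      (i := point.symm x) (mem_baseOrbit.2 ⟨fun j hj e => by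
        rw [e] at hxo
        exact basePoint_mem_octad hj hxo, by norm_num, fun _ => hxo⟩)
    rw [Equiv.apply_symm_apply] at hhx
    obtain ⟨hh, hfix⟩ := mem_baseStab.1 hh
    refine eq_one_of_conj_eq_one (h := h) (eq_one_of_fixes_base_five_six
      (conj_mem_mathieu24 hg hh) (by rwa [numFixed_conj])
      (fun k hk => conj_apply_eq (hfix k (by omega)) (hb k hk)) (conj_apply_eq hhx hx.1)
      (conj_apply_eq (x := h⁻¹ y) (by simp) hy.1) ?_ ?_)
    · rw [← eq_word_baseOctad (c := word baseOctad ∘ h) (comp_mem_golayCode hh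
        (word_mem_golayCode isOctadMask_baseOctad.1)) (by
          rw [hammingNorm_comp_perm, isOctadMask_baseOctad.hammingNorm_eq]) fun k hk => by
          rw [Function.comp_apply, hfix k (by omega)]
          exact basePoint_mem_octad (by omega)]
      simpa using hyo
    · intro e
      rw [Equiv.Perm.inv_eq_iff_eq, hhx] at e
      exact hxy e.symm

/-- A nontrivial element of `M₂₄` has at most eight fixed points: by 5-transitivity, five of them
may be assumed to lie in the base. -/
theorem numFixed_le_eight {g : Equiv.Perm ProjLine23} (hg : g ∈ mathieu24) (h1 : g ≠ 1) :
    numFixed g ≤ 8 := by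
  by_contra! h9
  obtain ⟨t, ht, htc⟩ := Finset.exists_subset_card_eq
    (show 5 ≤ (Finset.univ.filter fun p => g p = p).card by unfold numFixed at h9; omega)
  let e : Fin 5 ≃ t := (t.equivFinOfCardEq htc).symm
  let x : ℕ → ProjLine23 := fun k => if h : k < 5 then e ⟨k, h⟩ else none
  have hinj : Set.InjOn x (Set.Iio 5) := by
    intro i hi j hj hij
    rw [Set.mem_Iio] at hi hj
    simp only [x, hi, hj, dif_pos] at hij
    simpa using e.injective (Subtype.ext hij)
  have hgx : ∀ k < 5, g (x k) = x k := by
    intro k hk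
    have : x k ∈ t := by
      simp only [x, hk, dif_pos]
      exact (e _).2
    simpa using ht this
  obtain ⟨h, hh, hb⟩ := exists_map_basePoint_of_injOn le_rfl hinj
  exact h1 (eq_one_of_conj_eq_one (h := h) (eq_one_of_fixes_base_five (conj_mem_mathieu24 hg hh)
    (by rw [numFixed_conj]; omega) fun k hk => conj_apply_eq (hb k hk) (hgx k hk)))

/-! ### Orders of the stabilizers -/

theorem card_pointStab_singleton (a : ProjLine23) : Nat.card (pointStab {a}) = 10200960 := by
  have h := card_pointStab (s := ∅) (b := a) (S := Finset.univ) fun x => by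
    simp only [Finset.mem_univ, true_iff]
    obtain ⟨g, hg, hga⟩ := exists_map_basePoint_of_injOn (x := fun _ => a) (n := 1) (by norm_num)
      (by simp [Set.InjOn])
    obtain ⟨h, hh, hhx⟩ := exists_map_basePoint_of_injOn (x := fun _ => x) (n := 1) (by norm_num)
      (by simp [Set.InjOn])
    refine ⟨h * g⁻¹, mem_pointStab.2 ⟨mul_mem hh (inv_mem hg), by simp⟩, ?_⟩
    rw [← hga 0 one_pos, ← hhx 0 one_pos]
    simp
  have h0 : pointStab ∅ = mathieu24 := by
    ext g
    simp [mem_pointStab]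
  have hc : Fintype.card ProjLine23 = 24 := by simp [ProjLine23]
  rw [h0, card_mathieu24, Finset.card_univ, hc, insert_empty_eq] at h
  omega

theorem card_pointStab_pair {a b : ProjLine23} (hab : a ≠ b) :
    Nat.card (pointStab {a, b}) = 443520 := by
  have key : ∀ y, y ≠ a → ∃ g ∈ mathieu24, g (basePoint 0) = a ∧ g (basePoint 1) = y := by
    intro y hy
    obtain ⟨g, hg, hgx⟩ := exists_map_basePoint_of_injOn (x := fun k => if k = 0 then a else y)
      (n := 2) (by norm_num) (by
        intro i hi j hj hij
        rw [Set.mem_Iio] at hi hj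
        interval_cases i <;> interval_cases j <;> simp_all)
    exact ⟨g, hg, by simpa using hgx 0 (by norm_num), by simpa using hgx 1 (by norm_num)⟩
  have h := card_pointStab (s := {a}) (b := b) (S := Finset.univ.erase a) fun x => by
    simp only [Finset.mem_erase, Finset.mem_univ, and_true, mem_pointStab, Set.mem_singleton_iff,
      forall_eq]
    constructor
    · intro hx
      obtain ⟨g, hg, hga, hgb⟩ := key b hab.symm
      obtain ⟨h, hh, hha, hhx⟩ := key x hx
      refine ⟨h * g⁻¹, ⟨mul_mem hh (inv_mem hg), ?_⟩, ?_⟩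
      · conv_lhs => rw [← hga]
        simpa using hha
      · rw [← hgb]
        simpa using hhx
    · rintro ⟨g, ⟨-, hga⟩, rfl⟩ e
      exact hab (g.injective (hga.trans e.symm))
  have hc : Fintype.card ProjLine23 = 24 := by simp [ProjLine23]
  rw [card_pointStab_singleton, Finset.card_erase_of_mem (Finset.mem_univ a), Finset.card_univ, hc,
    Set.pair_comm] at h
  omega

/-- The action of a pointwise stabilizer on the remaining points is faithful. -/
theorem card_comap_ofSubtype {p : ProjLine23 → Prop} [DecidablePred p] {s : Set ProjLine23}
    (hs : ∀ x, x ∈ s ↔ ¬ p x) :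
    Nat.card (mathieu24.comap (Equiv.Perm.ofSubtype (p := p))) = Nat.card (pointStab s) := by
  refine Nat.card_congr (Equiv.ofBijective (fun g => ⟨Equiv.Perm.ofSubtype g.1, mem_pointStab.2
    ⟨g.2, fun x hx => Equiv.Perm.ofSubtype_apply_of_not_mem _ ((hs x).1 hx)⟩⟩) ⟨?_, ?_⟩)
  · intro g h e
    exact Subtype.ext (Equiv.Perm.ofSubtype_injective (Subtype.ext_iff.1 e))
  · rintro ⟨g, hg⟩
    obtain ⟨hg, hfix⟩ := mem_pointStab.1 hg
    have h2 : ∀ x, g x ≠ x → p x := fun x hx => by_contra fun h => hx (hfix x ((hs x).2 h))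
    have h1 : ∀ x, p (g x) ↔ p x := by
      intro x
      by_cases hx : g x = x
      · rw [hx]
      · exact ⟨fun _ => h2 x hx, fun _ => h2 _ fun e => hx (g.injective e)⟩
    have e : Equiv.Perm.ofSubtype (g.subtypePerm h1) = g := Equiv.Perm.ofSubtype_subtypePerm h1 h2
    exact ⟨⟨g.subtypePerm h1, by rw [Subgroup.mem_comap, e]; exact hg⟩, Subtype.ext e⟩

theorem ncard_fixedPoints_add_le_eight {p : ProjLine23 → Prop} [DecidablePred p]
    {g : Equiv.Perm {x // p x}} (hg : Equiv.Perm.ofSubtype g ∈ mathieu24) (h1 : g ≠ 1) :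
    (Function.fixedPoints g).ncard + (Finset.univ.filter fun x => ¬ p x).card ≤ 8 := by
  have h := numFixed_le_eight hg fun h => h1 (Equiv.Perm.ofSubtype_injective (by rw [h, map_one]))
  refine le_trans ?_ h
  have hd : Disjoint (Subtype.val '' Function.fixedPoints g)
      ((Finset.univ.filter fun x => ¬ p x : Finset ProjLine23) : Set ProjLine23) := by
    rw [Set.disjoint_left]
    rintro _ ⟨x, -, rfl⟩ hx
    simp [x.2] at hx
  rw [← Set.ncard_image_of_injective _ Subtype.val_injective, ← Set.ncard_coe_finset,
    ← Set.ncard_union_eq hd, numFixed, ← Set.ncard_coe_finset]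
  refine Set.ncard_le_ncard ?_
  rintro y (⟨x, hx, rfl⟩ | hy)
  · have : g x = x := hx
    simp [this]
  · have : ¬ p y := by simpa using hy
    simp [Equiv.Perm.ofSubtype_apply_of_not_mem g this]

/-! ### Fixity and permutation arrays -/

theorem exists_hasFixity {Ω : Type*} [Finite Ω] {G : Subgroup (Equiv.Perm Ω)} {f : ℕ}
    (h : ∀ g ∈ G, g ≠ 1 → (Function.fixedPoints g).ncard ≤ f) (hG : 1 < Nat.card G) :
    ∃ f' ≤ f, HasFixity G f' := by
  have : Nontrivial G := Finite.one_lt_card_iff_nontrivial.1 hG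
  obtain ⟨g₀, hg₀⟩ := exists_ne (1 : G)
  obtain ⟨g, ⟨hg, hg1⟩, hmax⟩ := Set.exists_max_image {g : Equiv.Perm Ω | g ∈ G ∧ g ≠ 1}
    (fun g => (Function.fixedPoints g).ncard) (Set.toFinite _)
    ⟨g₀, g₀.2, fun e => hg₀ (Subtype.ext e)⟩
  exact ⟨_, h g hg hg1, fun k hk hk1 => hmax k ⟨hk, hk1⟩, g, hg, hg1, rfl⟩

/-- Two elements `x` and `y` of a permutation group agree at the fixed points of `x⁻¹ * y`. -/
theorem isPermArray_of_ncard_fixedPoints_le {Ω : Type*} [Fintype Ω] [DecidableEq Ω]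
    {G : Subgroup (Equiv.Perm Ω)} {n d : ℕ} (hn : Fintype.card Ω = n)
    (h : ∀ g ∈ G, g ≠ 1 → (Function.fixedPoints g).ncard + d ≤ n) :
    IsPermArray n d (G : Set (Equiv.Perm Ω)) := by
  refine ⟨hn, fun x hx y hy hxy => ?_⟩
  have h1 := h (x⁻¹ * y) (G.mul_mem (G.inv_mem hx) hy) fun e => hxy (inv_mul_eq_one.1 e)
  have h2 : Function.fixedPoints ⇑(x⁻¹ * y) =
      ((Finset.univ.filter fun i => x i = y i : Finset Ω) : Set Ω) := by
    ext i
    rw [Function.mem_fixedPoints, Function.IsFixedPt, Equiv.Perm.mul_apply,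
      Equiv.Perm.inv_eq_iff_eq, Finset.mem_coe, Finset.mem_filter_univ, eq_comm]
  rw [h2, Set.ncard_coe_finset] at h1
  have h3 := Finset.card_filter_add_card_filter_not (s := Finset.univ) (fun i => x i = y i)
  rw [Finset.card_univ, hn] at h3
  change d ≤ (Finset.univ.filter fun i => x i ≠ y i).card
  simp only [ne_eq]
  omega

theorem IsPermArray.ncard_le_maxPermArray {Ω : Type*} [Fintype Ω] [DecidableEq Ω] {n d : ℕ}
    {C : Set (Equiv.Perm Ω)} (hC : IsPermArray n d C) : C.ncard ≤ maxPermArray n d := by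
  let e : Ω ≃ Fin n := Fintype.equivFinOfCardEq hC.1
  refine (maxPermArray_isGreatest n d).2 ⟨e.permCongr '' C, ⟨Fintype.card_fin n, ?_⟩,
    Set.ncard_image_of_injective C e.permCongr.injective⟩
  rintro _ ⟨x, hx, rfl⟩ _ ⟨y, hy, rfl⟩ hxy
  refine (hC.2 hx hy fun h => hxy (h ▸ rfl)).trans_eq (Finset.card_equiv e fun i => ?_)
  simp

theorem mainTheorem4 :
    ((∃ f ≤ 8, HasFixity mathieu24 f) ∧
      Nat.card mathieu24 = 244823040 ∧
      IsPermArray 24 16 (mathieu24 : Set (Equiv.Perm ProjLine23))) ∧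
    (∀ a : ProjLine23,
      (∃ f ≤ 7, HasFixity (mathieu23 a) f) ∧
      Nat.card (mathieu23 a) = 10200960 ∧
      IsPermArray 23 16 (mathieu23 a : Set (Equiv.Perm {x : ProjLine23 // x ≠ a}))) ∧
    (∀ a b : ProjLine23, a ≠ b →
      (∃ f ≤ 6, HasFixity (mathieu22 a b) f) ∧
      Nat.card (mathieu22 a b) = 443520 ∧
      IsPermArray 22 16 (mathieu22 a b : Set (Equiv.Perm {x : ProjLine23 // x ≠ a ∧ x ≠ b}))) ∧
    244823040 ≤ maxPermArray 24 16 ∧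
    10200960 ≤ maxPermArray 23 16 ∧
    443520 ≤ maxPermArray 22 16 := by
  have hc : Fintype.card ProjLine23 = 24 := by simp [ProjLine23]
  have fix24 : ∀ g ∈ mathieu24, g ≠ 1 → (Function.fixedPoints g).ncard ≤ 8 := by
    intro g hg h1
    have h := numFixed_le_eight hg h1
    rw [numFixed, ← Set.ncard_coe_finset] at h
    simpa [Function.fixedPoints, Function.IsFixedPt] using h
  have arr24 : IsPermArray 24 16 (mathieu24 : Set (Equiv.Perm ProjLine23)) :=
    isPermArray_of_ncard_fixedPoints_le hc fun g hg h1 => by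
      have := fix24 g hg h1
      omega
  have out23 : ∀ a : ProjLine23, (Finset.univ.filter fun x => ¬ x ≠ a).card = 1 := by
    intro a
    simp [Finset.filter_eq']
  have card23 : ∀ a, Nat.card (mathieu23 a) = 10200960 := fun a =>
    (card_comap_ofSubtype (s := {a}) fun x => by simp).trans (card_pointStab_singleton a)
  have fix23 : ∀ a, ∀ g ∈ mathieu23 a, g ≠ 1 → (Function.fixedPoints g).ncard ≤ 7 := by
    intro a g hg h1
    have := ncard_fixedPoints_add_le_eight hg h1
    rw [out23] at this
    omega
  have arr23 : ∀ a, IsPermArray 23 16 (mathieu23 a : Set (Equiv.Perm {x : ProjLine23 // x ≠ a})) :=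
    fun a => isPermArray_of_ncard_fixedPoints_le (by
      rw [Fintype.card_subtype_compl, hc, Fintype.card_subtype_eq]) fun g hg h1 => by
        have := fix23 a g hg h1
        omega
  have out22 : ∀ a b : ProjLine23, a ≠ b →
      (Finset.univ.filter fun x => ¬ (x ≠ a ∧ x ≠ b)).card = 2 := by
    intro a b hab
    rw [← Finset.card_pair hab]
    congr 1
    ext x
    simp only [Finset.mem_filter, Finset.mem_univ, true_and, Finset.mem_insert,
      Finset.mem_singleton]
    tauto
  have card22 : ∀ a b, a ≠ b → Nat.card (mathieu22 a b) = 443520 := fun a b hab =>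
    (card_comap_ofSubtype (s := {a, b}) fun x => by
      simp only [Set.mem_insert_iff, Set.mem_singleton_iff]
      tauto).trans (card_pointStab_pair hab)
  have fix22 : ∀ a b, a ≠ b → ∀ g ∈ mathieu22 a b, g ≠ 1 →
      (Function.fixedPoints g).ncard ≤ 6 := by
    intro a b hab g hg h1
    have := ncard_fixedPoints_add_le_eight hg h1
    rw [out22 a b hab] at this
    omega
  have arr22 : ∀ a b, a ≠ b →
      IsPermArray 22 16 (mathieu22 a b : Set (Equiv.Perm {x : ProjLine23 // x ≠ a ∧ x ≠ b})) :=
    fun a b hab => isPermArray_of_ncard_fixedPoints_le (by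
      have := Finset.card_filter_add_card_filter_not (s := Finset.univ)
        (fun x : ProjLine23 => x ≠ a ∧ x ≠ b)
      rw [out22 a b hab, Finset.card_univ, hc] at this
      rw [Fintype.card_subtype]
      omega) fun g hg h1 => by
        have := fix22 a b hab g hg h1
        omega
  have h01 : (none : ProjLine23) ≠ some 0 := by simp
  refine ⟨⟨exists_hasFixity fix24 (by rw [card_mathieu24]; norm_num), card_mathieu24, arr24⟩,
    fun a => ⟨exists_hasFixity (fix23 a) (by rw [card23]; norm_num), card23 a, arr23 a⟩,
    fun a b hab => ⟨exists_hasFixity (fix22 a b hab) (by rw [card22 a b hab]; norm_num),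
      card22 a b hab, arr22 a b hab⟩, ?_, ?_, ?_⟩
  · exact card_mathieu24.symm.trans_le arr24.ncard_le_maxPermArray
  · exact (card23 none).symm.trans_le (arr23 none).ncard_le_maxPermArray
  · exact (card22 _ _ h01).symm.trans_le (arr22 _ _ h01).ncard_le_maxPermArray
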